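/- Let $\mathcal A$ be a commutative (not necessarily unital) $C^*$-algebra and let $\widehat{\mathcal A}$ be its spectrum, that is, the space of characters (non-zero continuous multiplicative linear functionals) of $\mathcal A$ with the weak-$*$ topology, so that $\mathcal A\cong C_0(\widehat{\mathcal A})$. Suppose that $\widehat{\mathcal A}$ satisfies the Suslin condition: its Suslin number, i.e. the smallest cardinal $m\ge\aleph_0$ such that every family of non-empty, open, pairwise disjoint subsets of $\widehat{\mathcal A}$ has cardinality at most $m$, equals $\aleph_0$. Then the following conditions are equivalent: (i) $\mathcal A$ is left projective, i.e. projective in the category of left Banach $\mathcal A$-modules: for every left Banach $\mathcal A$-module $Y$ and every morphism of left Banach $\mathcal A$-modules $\varphi:Y\to\mathcal A$ that has a bounded linear right inverse, there is a morphism of left Banach $\mathcal A$-modules $\psi:\mathcal A\to Y$ with $\varphi\circ\psi=\mathrm{id}_{\mathcal A}$; (ii) $\widehat{\mathcal A}$ is paracompact; (iii) $\mathcal A$ contains a strictly positive element, i.e. an element $a\ge 0$ with $f(a)>0$ for every non-zero positive linear functional $f$ on $\mathcal A$; (iv) $\widehat{\mathcal A}$ is $\sigma$-compact; (v) $\widehat{\mathcal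 A}$ is a Lindelöf space; (vi) $\mathcal A$ has a sequential approximate identity bounded by one, i.e. a sequence $(e_n)$ with $\|e_n\|\le 1$ for all $n$ and $\|e_na-a\|\to0$, $\|ae_n-a\|\to0$ for every $a\in\mathcal A$; (vii) $\mathcal H^2(\mathcal A,X)=\{0\}$ for every Banach $\mathcal A$-bimodule $X$ that is right annihilator, i.e. satisfies $x\cdot a=0$ for all $x\in X$, $a\in\mathcal A$. Here $\mathcal H^2(\mathcal A,X)=\ker\delta^2/\operatorname{im}\delta^1$ is the second continuous Hochschild cohomology group, where for bounded linear $g:\mathcal A\to X$ and bounded bilinear $f:\mathcal A\times\mathcal A\to X$ $$(\delta^1g)(a,b)=a\cdot g(b)-g(ab)+g(a)\cdot b,\qquad (\delta^2f)(a,b,c)=a\cdot f(b,c)-f(ab,c)+f(a,bc)-f(a,b)\cdot c.$$ A left Banach $\mathcal A$-module (Banach $\mathcal A$-bimodule) is a complex Banach space with a bounded bilinear associative left multiplication (commuting bounded bilinear associative left and right multiplications) by $\mathcal A$; morphisms are the bounded linear maps that commute with the multiplication. -/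

import Mathlib

open scoped ComplexOrder

universe u

set_option maxSynthPendingDepth 3

namespace BanachHomology

section Topology

/-- The Suslin number of a topological space: the smallest cardinal `m ≥ ℵ₀` such that every
family of non-empty, open, pairwise disjoint subsets has cardinality at most `m`. -/
noncomputable def suslinNumber (Ω : Type u) [TopologicalSpace Ω] : Cardinal.{u} :=
  sInf {m : Cardinal.{u} | Cardinal.aleph0 ≤ m ∧
    ∀ S : Set (Set Ω), (∀ U ∈ S, IsOpen U ∧ U.Nonempty) →
      S.PairwiseDisjoint id → Cardinal.mk S ≤ m}

/-- The Suslin condition: the Suslin number is `ℵ₀`. -/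
def SuslinCondition (Ω : Type u) [TopologicalSpace Ω] : Prop :=
  suslinNumber Ω = Cardinal.aleph0

end Topology

section Modules

variable (A : Type u) [NonUnitalNormedRing A] [NormedSpace ℂ A]

/-- The structure of a left Banach `A`-module on a normed space `X`: a bounded bilinear
associative multiplication `A × X → X`. (`A` need not be unital; completeness of `X` is required
separately, wherever modules are quantified over.) -/
structure LeftAction (X : Type u) [NormedAddCommGroup X] [NormedSpace ℂ X] where
  /-- The multiplication `(a, x) ↦ a · x`. -/
  act : A →L[ℂ] X →L[ℂ] X
  mul_act : ∀ (a b : A) (x : X), act (a * b) x = act a (act b x)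

/-- The structure of a Banach `A`-bimodule on a normed space `X`: `left a x = a · x` and
`right a x = x · a`. -/
structure BiAction (X : Type u) [NormedAddCommGroup X] [NormedSpace ℂ X] where
  /-- The left multiplication `(a, x) ↦ a · x`. -/
  left : A →L[ℂ] X →L[ℂ] X
  /-- The right multiplication `(a, x) ↦ x · a`. -/
  right : A →L[ℂ] X →L[ℂ] X
  mul_left : ∀ (a b : A) (x : X), left (a * b) x = left a (left b x)
  mul_right : ∀ (a b : A) (x : X), right (a * b) x = right b (right a x)
  left_right : ∀ (a b : A) (x : X), right b (left a x) = left a (right b x)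

variable {A}

/-- A bounded linear map between left Banach modules is a morphism of left modules. -/
def IsModuleHom {X Y : Type u} [NormedAddCommGroup X] [NormedSpace ℂ X]
    [NormedAddCommGroup Y] [NormedSpace ℂ Y]
    (αX : LeftAction A X) (αY : LeftAction A Y) (φ : X →L[ℂ] Y) : Prop :=
  ∀ (a : A) (x : X), φ (αX.act a x) = αY.act a (φ x)

/-- Projectivity of a left Banach module `P` in the category of left Banach `A`-modules: every
module morphism `φ : Y → P` that has a right inverse as a morphism of Banach spaces (so that `φ`
is in particular an epimorphism) has a right inverse that is a morphism of modules. -/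
def IsProjectiveModule {P : Type u} [NormedAddCommGroup P] [NormedSpace ℂ P]
    (αP : LeftAction A P) : Prop :=
  ∀ (Y : Type u) [NormedAddCommGroup Y] [NormedSpace ℂ Y] [CompleteSpace Y]
    (αY : LeftAction A Y) (φ : Y →L[ℂ] P), IsModuleHom αY αP φ →
    (∃ σ : P →L[ℂ] Y, φ.comp σ = ContinuousLinearMap.id ℂ P) →
    ∃ ψ : P →L[ℂ] Y, IsModuleHom αP αY ψ ∧ φ.comp ψ = ContinuousLinearMap.id ℂ P

/-- A bimodule is right annihilator if `x · a = 0` for all `x` and `a`. -/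
def BiAction.IsRightAnnihilator {X : Type u} [NormedAddCommGroup X] [NormedSpace ℂ X]
    (β : BiAction A X) : Prop :=
  ∀ (a : A) (x : X), β.right a x = 0

variable [IsScalarTower ℂ A A] [SMulCommClass ℂ A A]

variable (A) in
/-- `A` as a left module over itself. -/
noncomputable def LeftAction.regular : LeftAction A A where
  act := ContinuousLinearMap.mul ℂ A
  mul_act a b x := mul_assoc a b x

variable (A) in
/-- The algebra `A` is left projective: it is projective as a left Banach module over itself. -/
def IsLeftProjective : Prop :=
  IsProjectiveModule (LeftAction.regular A)

end Modules

section Cohomology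

/-- The cohomology `ker d' / im d` of `U → V → W` at `V` (used where `d' ∘ d = 0`). -/
abbrev CohomologyAt {U V W : Type u} [AddCommGroup U] [Module ℂ U] [AddCommGroup V] [Module ℂ V]
    [AddCommGroup W] [Module ℂ W] (d : U →ₗ[ℂ] V) (d' : V →ₗ[ℂ] W) : Type u :=
  LinearMap.ker d' ⧸ (LinearMap.range d).comap (LinearMap.ker d').subtype

variable {A : Type u} [NonUnitalNormedRing A] [NormedSpace ℂ A]
  [IsScalarTower ℂ A A] [SMulCommClass ℂ A A]
  {X : Type u} [NormedAddCommGroup X] [NormedSpace ℂ X]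

/-- The coboundary operator `δ¹ : C¹(A, X) → C²(A, X)` of the standard complex,
see `delta1_apply`. -/
noncomputable def BiAction.delta1 (β : BiAction A X) :
    (A →L[ℂ] X) →ₗ[ℂ] (A →L[ℂ] A →L[ℂ] X) where
  toFun g :=
    ((ContinuousLinearMap.compL ℂ A X X).flip g).comp β.left
      - (ContinuousLinearMap.compL ℂ A A X g).comp (ContinuousLinearMap.mul ℂ A)
      + β.right.flip.comp g
  map_add' g h := by
    ext a b
    simp
    abel
  map_smul' c g := by
    ext a b
    simp [smul_sub]

theorem BiAction.delta1_apply (β : BiAction A X) (g : A →L[ℂ] X) (a b : A) :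
    β.delta1 g a b = β.left a (g b) - g (a * b) + β.right b (g a) := rfl

/-- The coboundary operator `δ² : C²(A, X) → C³(A, X)` of the standard complex,
see `delta2_apply`. -/
noncomputable def BiAction.delta2 (β : BiAction A X) :
    (A →L[ℂ] A →L[ℂ] X) →ₗ[ℂ] (A →L[ℂ] A →L[ℂ] A →L[ℂ] X) where
  toFun f :=
    ((ContinuousLinearMap.compL ℂ A (A →L[ℂ] X) (A →L[ℂ] X)).flip f).comp
        ((ContinuousLinearMap.compL ℂ A X X).comp β.left)
      - (ContinuousLinearMap.compL ℂ A A (A →L[ℂ] X) f).comp (ContinuousLinearMap.mul ℂ A)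
      + ((ContinuousLinearMap.compL ℂ A (A →L[ℂ] A) (A →L[ℂ] X)).flip
          (ContinuousLinearMap.mul ℂ A)).comp ((ContinuousLinearMap.compL ℂ A A X).comp f)
      - (ContinuousLinearMap.compL ℂ A X (A →L[ℂ] X) β.right.flip).comp f
  map_add' f h := by
    ext a b c
    simp
    abel
  map_smul' r f := by
    ext a b c
    simp [smul_sub]

theorem BiAction.delta2_apply (β : BiAction A X) (f : A →L[ℂ] A →L[ℂ] X) (a b c : A) :
    β.delta2 f a b c =
      β.left a (f b c) - f (a * b) c + f a (b * c) - β.right c (f a b) := rfl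

theorem BiAction.delta2_delta1 (β : BiAction A X) (g : A →L[ℂ] X) :
    β.delta2 (β.delta1 g) = 0 := by
  ext a b c
  simp only [BiAction.delta2_apply, BiAction.delta1_apply, map_add, map_sub, β.mul_left,
    β.mul_right, β.left_right, mul_assoc, zero_apply]
  abel

/-- The second continuous Hochschild cohomology group `H²(A, X) = ker δ² / im δ¹`. -/
abbrev BiAction.H2 (β : BiAction A X) : Type u :=
  CohomologyAt β.delta1 β.delta2

end Cohomology

section CStar

variable {A : Type u} [NonUnitalCStarAlgebra A] [PartialOrder A] [StarOrderedRing A]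

/-- An element of a (not necessarily unital) C*-algebra is strictly positive if it is positive and
every non-zero positive linear functional takes a value `> 0` on it. (Mathlib's
`IsStrictlyPositive` is a different notion: it asks for invertibility.) -/
def StrictlyPositiveElement (a : A) : Prop :=
  0 ≤ a ∧ ∀ f : A →ₚ[ℂ] ℂ, f ≠ 0 → 0 < f a

end CStar

/-- A sequence `e` is an approximate identity bounded by one. -/
def IsSeqApproxIdentityBoundedByOne {A : Type u} [NonUnitalNormedRing A] (e : ℕ → A) : Prop :=
  (∀ n, ‖e n‖ ≤ 1) ∧ (Filter.map e Filter.atTop).IsApproximateUnit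

end BanachHomology

/-!
Local compactness of the spectrum `Â` makes every condition comparable with σ-compactness, which
is the existence of a sequence in `A` without common zeros on `Â`; for paracompactness this uses
that under the Suslin condition a locally finite family of non-empty open sets is countable.

If `A` is left projective, lift it along the module of pairs `(F, a)`, `F : Â → A`, with
`χ (F χ) = χ a`. By commutativity the lift, divided by `χ a`, does not depend on `a`, so it glues to
a continuous `G : Â → A` with `χ (G χ) = 1`. Where `G` is close to `G χ`, the transform of `G χ` is
bounded below, so the preimages under `G` of small balls are relatively compact; by the Suslin
condition countably many of them have dense union, and slightly larger ones cover `Â`.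

Conversely, cutoffs of a positive element without zeros form an approximate unit `e` with
`e n * e (n + 1) = e n`. With `u n = e (n + 2) - e (n + 1)` and `v n = e (n + 3) - e n` we have
`u n * v n = u n`. If `σ` is a bounded linear right inverse of a morphism onto `A`, a module lift is
`b ↦ (b * e 1) · σ (e 2) + ∑ (b * u n) · σ (v n)`. The series converges by averaging over signs,
because `∑ |χ (b * u n)|` is small over tails and `∑ |χ (v n)| ≤ 3`, uniformly in `χ`.

For right annihilator bimodules, 2-cocycles are the extensions of `A` by a left module and
coboundaries are the split ones, so projectivity of `A` is the vanishing of `H²`.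
-/

namespace BanachHomology

open WeakDual Filter Topology

section Characters

variable {𝕜 A : Type*} [NontriviallyNormedField 𝕜] [NonUnitalNormedRing A] [NormedSpace 𝕜 A]

theorem continuous_eval_character (a : A) : Continuous fun χ : characterSpace 𝕜 A => χ a :=
  (eval_continuous a).comp continuous_subtype_val

theorem exists_character_ne_zero (χ : characterSpace 𝕜 A) : ∃ a, χ a ≠ 0 := by
  by_contra! h
  exact χ.2.1 (ContinuousLinearMap.ext h)

theorem norm_character_le (χ : characterSpace 𝕜 A) (a : A) : ‖χ a‖ ≤ ‖a‖ := by
  set C := ‖CharacterSpace.toCLM χ‖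
  have hC (a : A) : ‖χ a‖ ≤ C * ‖a‖ := (CharacterSpace.toCLM χ).le_opNorm a
  have hsq (a : A) : ‖χ a‖ ≤ √C * ‖a‖ := by
    refine abs_le_of_sq_le_sq' ?_ (by positivity) |>.2
    calc ‖χ a‖ ^ 2 = ‖χ (a * a)‖ := by rw [map_mul, norm_mul, sq]
      _ ≤ C * (‖a‖ * ‖a‖) := (hC _).trans (by gcongr; exact norm_mul_le a a)
      _ = (√C * ‖a‖) ^ 2 := by rw [mul_pow, Real.sq_sqrt (norm_nonneg _), sq]
  have hC1 : C ≤ 1 := by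
    have hle : C ≤ √C := (CharacterSpace.toCLM χ).opNorm_le_bound (Real.sqrt_nonneg _) hsq
    nlinarith [Real.sq_sqrt (norm_nonneg (CharacterSpace.toCLM χ)), Real.sqrt_nonneg C]
  exact (hC a).trans (mul_le_of_le_one_left (norm_nonneg a) hC1)

theorem isCompact_character_ge [ProperSpace 𝕜] (a : A) {ε : ℝ} (hε : 0 < ε) :
    IsCompact {χ : characterSpace 𝕜 A | ε ≤ ‖χ a‖} := by
  rw [Subtype.isCompact_iff]
  have himage : ((↑) '' {χ : characterSpace 𝕜 A | ε ≤ ‖χ a‖} : Set (WeakDual 𝕜 A)) =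
      {φ : WeakDual 𝕜 A | ∀ x y : A, φ (x * y) = φ x * φ y} ∩ {φ | ε ≤ ‖φ a‖} := by
    ext φ
    constructor
    · rintro ⟨χ, hχ, rfl⟩
      exact ⟨χ.2.2, hχ⟩
    · rintro ⟨hmul, hφ⟩
      refine ⟨⟨φ, ?_, hmul⟩, hφ, rfl⟩
      rintro rfl
      exact hε.not_ge (hφ.trans_eq norm_zero)
  have hclosed : IsClosed ((↑) '' {χ : characterSpace 𝕜 A | ε ≤ ‖χ a‖} : Set (WeakDual 𝕜 A)) := by
    rw [himage, ← CharacterSpace.union_zero]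
    exact (CharacterSpace.union_zero_isClosed 𝕜 A).inter
      (isClosed_le continuous_const (eval_continuous a).norm)
  refine (isCompact_closedBall (𝕜 := 𝕜) (0 : StrongDual 𝕜 A) 1).of_isClosed_subset hclosed ?_
  rintro _ ⟨χ, -, rfl⟩
  rw [Set.mem_preimage, mem_closedBall_zero_iff]
  refine ContinuousLinearMap.opNorm_le_bound _ zero_le_one fun x => ?_
  rw [one_mul]
  exact norm_character_le χ x

instance instWeaklyLocallyCompactSpaceCharacterSpace [ProperSpace 𝕜] :
    WeaklyLocallyCompactSpace (characterSpace 𝕜 A) where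
  exists_compact_mem_nhds χ := by
    obtain ⟨a, ha⟩ := exists_character_ne_zero χ
    have hpos : 0 < ‖χ a‖ := norm_pos_iff.2 ha
    exact ⟨_, isCompact_character_ge a (half_pos hpos),
      ((continuous_eval_character a).norm.tendsto χ).eventually_const_le (half_lt_self hpos)⟩

theorem exists_seq_character_ne_zero [SigmaCompactSpace (characterSpace 𝕜 A)] :
    ∃ e : ℕ → A, ∀ χ : characterSpace 𝕜 A, ∃ n, χ (e n) ≠ 0 := by
  choose b hb using exists_character_ne_zero (𝕜 := 𝕜) (A := A)
  obtain ⟨t, ht, hcover⟩ := LindelofSpace.elim_nhds_subcover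
    (fun χ : characterSpace 𝕜 A => {χ' : characterSpace 𝕜 A | χ' (b χ) ≠ 0}) fun χ =>
      (continuous_eval_character (b χ)).continuousAt.eventually_ne (hb χ)
  obtain ⟨e, he⟩ := ((ht.image b).insert 0).exists_eq_range (Set.insert_nonempty _ _)
  refine ⟨e, fun χ => ?_⟩
  obtain ⟨χ', hχ', hne⟩ := Set.mem_iUnion₂.1 (hcover.symm ▸ Set.mem_univ χ)
  obtain ⟨n, hn⟩ := he.subset (Set.mem_insert_of_mem _ (Set.mem_image_of_mem b hχ'))
  exact ⟨n, hn ▸ hne⟩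

theorem isSigmaCompact_character_ne_zero [ProperSpace 𝕜] (a : A) :
    IsSigmaCompact {χ : characterSpace 𝕜 A | χ a ≠ 0} := by
  have hunion : {χ : characterSpace 𝕜 A | χ a ≠ 0} = ⋃ k : ℕ, {χ | 1 / ((k : ℝ) + 1) ≤ ‖χ a‖} := by
    ext χ
    simp only [Set.mem_ofPred_eq, Set.mem_iUnion]
    refine ⟨fun h => ?_, fun ⟨k, hk⟩ h => ?_⟩
    · obtain ⟨k, hk⟩ := exists_nat_one_div_lt (norm_pos_iff.2 h)
      exact ⟨k, hk.le⟩
    · rw [h, norm_zero] at hk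
      exact absurd hk (not_le.2 Nat.one_div_pos_of_nat)
  rw [hunion]
  exact isSigmaCompact_iUnion_of_isCompact _ fun k =>
    isCompact_character_ge a Nat.one_div_pos_of_nat

theorem sigmaCompactSpace_characterSpace_iff [ProperSpace 𝕜] :
    SigmaCompactSpace (characterSpace 𝕜 A) ↔
      ∃ e : ℕ → A, ∀ χ : characterSpace 𝕜 A, ∃ n, χ (e n) ≠ 0 := by
  refine ⟨fun _ => exists_seq_character_ne_zero, fun ⟨e, he⟩ => ?_⟩
  rw [← isSigmaCompact_univ_iff,
    ← Set.iUnion_eq_univ_iff (f := fun n => {χ : characterSpace 𝕜 A | χ (e n) ≠ 0}) |>.2 he]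
  exact isSigmaCompact_iUnion _ fun n => isSigmaCompact_character_ne_zero (e n)

theorem IsSeqApproxIdentityBoundedByOne.exists_character_ne_zero {e : ℕ → A}
    (he : IsSeqApproxIdentityBoundedByOne e) (χ : characterSpace 𝕜 A) : ∃ n, χ (e n) ≠ 0 := by
  by_contra! hzero
  obtain ⟨a, ha⟩ := BanachHomology.exists_character_ne_zero χ
  have hlim : Tendsto (fun n => χ (a * e n)) atTop (𝓝 (χ a)) :=
    ((map_continuous χ).tendsto a).comp (he.2.tendsto_mul_left a)
  refine ha (tendsto_nhds_unique hlim ?_)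
  simp only [map_mul, hzero, mul_zero, tendsto_const_nhds]

end Characters

section SuslinCondition

variable {Ω : Type u} [TopologicalSpace Ω]

theorem SuslinCondition.countable (h : SuslinCondition Ω) {S : Set (Set Ω)}
    (hS : ∀ U ∈ S, IsOpen U ∧ U.Nonempty) (hd : S.PairwiseDisjoint id) : S.Countable := by
  have hne : {m : Cardinal.{u} | Cardinal.aleph0 ≤ m ∧
      ∀ S : Set (Set Ω), (∀ U ∈ S, IsOpen U ∧ U.Nonempty) →
        S.PairwiseDisjoint id → Cardinal.mk S ≤ m}.Nonempty := by
    rw [Set.nonempty_iff_ne_empty]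
    intro hempty
    rw [SuslinCondition, suslinNumber, hempty, Cardinal.sInf_empty] at h
    exact Cardinal.aleph0_ne_zero h.symm
  rw [← Cardinal.le_aleph0_iff_set_countable]
  exact ((csInf_mem hne).2 S hS hd).trans_eq h

theorem SuslinCondition.exists_countable_dense_iUnion (h : SuslinCondition Ω) {ι : Type*}
    {U : ι → Set Ω} (hU : ∀ i, IsOpen (U i)) (hcover : ⋃ i, U i = Set.univ) :
    ∃ t : Set ι, t.Countable ∧ Dense (⋃ i ∈ t, U i) := by
  let T : Set (Set Ω) := {V | IsOpen V ∧ V.Nonempty ∧ ∃ i, V ⊆ U i}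
  obtain ⟨S, hST, hdisj, hmax⟩ := Vitali.exists_disjoint_subfamily_covering_enlargement id T 0 2
    one_lt_two (fun _ _ => le_rfl) 0 (fun _ _ => le_rfl) fun V hV => hV.2.1
  choose i hi using fun V : S => (hST V.2).2.2
  have hS : Countable S := (h.countable (fun V hV => ⟨(hST hV).1, (hST hV).2.1⟩) hdisj).to_subtype
  refine ⟨Set.range i, Set.countable_range i, ?_⟩
  rw [Set.biUnion_range, dense_iff_inter_open]
  rintro W hW ⟨x, hx⟩
  obtain ⟨j, hj⟩ := Set.iUnion_eq_univ_iff.1 hcover x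
  obtain ⟨V, hV, ⟨y, hyW, hyV⟩, -⟩ :=
    hmax (W ∩ U j) ⟨hW.inter (hU j), ⟨x, hx, hj⟩, j, Set.inter_subset_right⟩
  exact ⟨y, hyW.1, Set.mem_iUnion.2 ⟨⟨V, hV⟩, hi ⟨V, hV⟩ hyV⟩⟩

theorem SuslinCondition.countable_of_locallyFinite (h : SuslinCondition Ω) {ι : Type*}
    {U : ι → Set Ω} (hU : ∀ i, IsOpen (U i)) (hf : LocallyFinite U) :
    {i | (U i).Nonempty}.Countable := by
  choose N hN hfin using hf
  obtain ⟨t, ht, hdense⟩ := h.exists_countable_dense_iUnion (U := fun x => interior (N x))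
    (fun x => isOpen_interior)
    (Set.iUnion_eq_univ_iff.2 fun x => ⟨x, mem_interior_iff_mem_nhds.2 (hN x)⟩)
  refine (ht.biUnion fun x _ => (hfin x).countable).mono fun i hi => ?_
  obtain ⟨y, hy, hyt⟩ := hdense.inter_open_nonempty _ (hU i) hi
  obtain ⟨x, hx, hyx⟩ := Set.mem_iUnion₂.1 hyt
  exact Set.mem_biUnion hx ⟨y, hy, interior_subset hyx⟩

theorem SuslinCondition.sigmaCompactSpace_of_paracompactSpace [T2Space Ω]
    [WeaklyLocallyCompactSpace Ω] [ParacompactSpace Ω] (h : SuslinCondition Ω) :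
    SigmaCompactSpace Ω := by
  choose K hK hKn using fun x : Ω => exists_compact_mem_nhds x
  obtain ⟨V, hV, hcover, hlf, hVK⟩ := precise_refinement (fun x => interior (K x))
    (fun x => isOpen_interior) (Set.iUnion_eq_univ_iff.2 fun x =>
      ⟨x, mem_interior_iff_mem_nhds.2 (hKn x)⟩)
  refine SigmaCompactSpace.of_countable (K '' {i | (V i).Nonempty})
    ((h.countable_of_locallyFinite hV hlf).image K) (Set.forall_mem_image.2 fun i _ => hK i) ?_
  refine Set.eq_univ_of_forall fun x => ?_
  obtain ⟨i, hi⟩ := Set.iUnion_eq_univ_iff.1 hcover x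
  exact ⟨K i, Set.mem_image_of_mem K ⟨x, hi⟩, interior_subset (hVK i hi)⟩

theorem sigmaCompactSpace_of_lindelofSpace [WeaklyLocallyCompactSpace Ω] [LindelofSpace Ω] :
    SigmaCompactSpace Ω := by
  choose K hK hKn using fun x : Ω => exists_compact_mem_nhds x
  obtain ⟨t, ht, hcover⟩ := LindelofSpace.elim_nhds_subcover K hKn
  refine SigmaCompactSpace.of_countable (K '' t) (ht.image K)
    (Set.forall_mem_image.2 fun i _ => hK i) ?_
  rw [Set.sUnion_image, hcover]

theorem SuslinCondition.sigmaCompactSpace_of_continuous {E : Type*} [PseudoMetricSpace E]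
    (h : SuslinCondition Ω) {G : Ω → E} (hG : Continuous G) {r : ℝ} (hr : 0 < r)
    (hK : ∀ x, ∃ K : Set Ω, IsCompact K ∧ ∀ y, dist (G y) (G x) < r → y ∈ K) :
    SigmaCompactSpace Ω := by
  choose K hK hball using hK
  obtain ⟨t, ht, hdense⟩ := h.exists_countable_dense_iUnion
    (U := fun x => G ⁻¹' Metric.ball (G x) (r / 2)) (fun x => Metric.isOpen_ball.preimage hG)
    (Set.iUnion_eq_univ_iff.2 fun x => ⟨x, Metric.mem_ball_self (half_pos hr)⟩)
  refine SigmaCompactSpace.of_countable (K '' t) (ht.image K)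
    (Set.forall_mem_image.2 fun x _ => hK x) (Set.eq_univ_of_forall fun y => ?_)
  obtain ⟨z, hzy, hz⟩ := hdense.inter_open_nonempty _
    (Metric.isOpen_ball.preimage hG : IsOpen (G ⁻¹' Metric.ball (G y) (r / 2)))
    ⟨y, Metric.mem_ball_self (half_pos hr)⟩
  obtain ⟨x, hx, hzx⟩ := Set.mem_iUnion₂.1 hz
  refine ⟨K x, Set.mem_image_of_mem K hx, hball x y ?_⟩
  calc dist (G y) (G x) ≤ dist (G z) (G y) + dist (G z) (G x) := dist_triangle_left _ _ _
    _ < r / 2 + r / 2 := add_lt_add hzy hzx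
    _ = r := add_halves r

end SuslinCondition

section CodRestrict

variable {𝕜 E F G : Type*} [NontriviallyNormedField 𝕜] [NormedAddCommGroup E] [NormedSpace 𝕜 E]
  [NormedAddCommGroup F] [NormedSpace 𝕜 F] [NormedAddCommGroup G] [NormedSpace 𝕜 G]

/-- A bounded bilinear map with values in a subspace `p`, as a bounded bilinear map into `p`. -/
noncomputable def codRestrict₂ (f : E →L[𝕜] F →L[𝕜] G) (p : Submodule 𝕜 G)
    (h : ∀ x y, f x y ∈ p) : E →L[𝕜] F →L[𝕜] p :=
  LinearMap.mkContinuous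
    { toFun x := (f x).codRestrict p (h x)
      map_add' x y := by ext z; simp
      map_smul' c x := by ext z; simp } ‖f‖ fun x =>
    ContinuousLinearMap.opNorm_le_bound _ (by positivity) (f.le_opNorm₂ x)

end CodRestrict

section Extensions

variable {A : Type u} [NonUnitalNormedRing A] [NormedSpace ℂ A]
  {X Y Z : Type u} [NormedAddCommGroup X] [NormedSpace ℂ X] [NormedAddCommGroup Y]
  [NormedSpace ℂ Y] [NormedAddCommGroup Z] [NormedSpace ℂ Z]

/-- The submodule of a left module given by an invariant subspace. -/
noncomputable def LeftAction.restrict (α : LeftAction A X) (p : Submodule ℂ X)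
    (hp : ∀ a, ∀ x ∈ p, α.act a x ∈ p) : LeftAction A p where
  act := codRestrict₂ (α.act.bilinearComp (.id ℂ A) p.subtypeL) p fun a x => hp a x x.2
  mul_act a b x := Subtype.ext (α.mul_act a b x)

/-- The bimodule with zero right multiplication on a left module. -/
noncomputable def BiAction.ofLeft (α : LeftAction A X) : BiAction A X where
  left := α.act
  right := 0
  mul_left := α.mul_act
  mul_right _ _ _ := rfl
  left_right a b x := by simp

theorem BiAction.isRightAnnihilator_ofLeft (α : LeftAction A X) :
    (BiAction.ofLeft α).IsRightAnnihilator := fun _ _ => rfl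

/-- The left module underlying a bimodule. -/
def BiAction.toLeftAction (β : BiAction A X) : LeftAction A X where
  act := β.left
  mul_act := β.mul_left

/-- A `2`-cocycle on `A × Z` with values in `X`: these are the bilinear maps that define extensions
of the left module `Z` by the left module `X`. -/
def IsExtensionCocycle (α : LeftAction A X) (γ : LeftAction A Z) (f : A →L[ℂ] Z →L[ℂ] X) : Prop :=
  ∀ a b z, f (a * b) z = α.act a (f b z) + f a (γ.act b z)

/-- The extension of `γ` by `α` that an extension cocycle defines on the product. -/
noncomputable def LeftAction.ofCocycle (α : LeftAction A X) (γ : LeftAction A Z)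
    {f : A →L[ℂ] Z →L[ℂ] X} (hf : IsExtensionCocycle α γ f) : LeftAction A (X × Z) where
  act := (ContinuousLinearMap.prodₗᵢ ℂ).toContinuousLinearEquiv.toContinuousLinearMap ∘L
    (α.act.bilinearComp (.id ℂ A) (.fst ℂ X Z) + f.bilinearComp (.id ℂ A) (.snd ℂ X Z)).prod
      (γ.act.bilinearComp (.id ℂ A) (.snd ℂ X Z))
  mul_act a b x := by
    have hfst : α.act (a * b) x.1 + f (a * b) x.2 =
        α.act a (α.act b x.1 + f b x.2) + f a (γ.act b x.2) := by
      rw [α.mul_act, hf, map_add, add_assoc]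
    exact Prod.ext hfst (γ.mul_act a b x.2)

@[simp]
theorem LeftAction.ofCocycle_act (α : LeftAction A X) (γ : LeftAction A Z)
    {f : A →L[ℂ] Z →L[ℂ] X} (hf : IsExtensionCocycle α γ f) (a : A) (x : X × Z) :
    (LeftAction.ofCocycle α γ hf).act a x = (α.act a x.1 + f a x.2, γ.act a x.2) := rfl

/-- The product of two left modules, which is their split extension. -/
noncomputable def LeftAction.prod (α : LeftAction A X) (γ : LeftAction A Z) :
    LeftAction A (X × Z) :=
  LeftAction.ofCocycle α γ (f := 0) fun a b z => by simp

@[simp]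
theorem LeftAction.prod_act (α : LeftAction A X) (γ : LeftAction A Z) (a : A) (x : X × Z) :
    (α.prod γ).act a x = (α.act a x.1, γ.act a x.2) :=
  Prod.ext (add_zero _) rfl

/-- The failure `(a, z) ↦ a · σ z - σ (a · z)` of a bounded linear map to be a morphism of left
modules. -/
noncomputable def moduleDefect (γ : LeftAction A Z) (α : LeftAction A Y) (σ : Z →L[ℂ] Y) :
    A →L[ℂ] Z →L[ℂ] Y :=
  α.act.bilinearComp (.id ℂ A) σ - (ContinuousLinearMap.compL ℂ Z Z Y σ) ∘L γ.act

@[simp]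
theorem moduleDefect_apply (γ : LeftAction A Z) (α : LeftAction A Y) (σ : Z →L[ℂ] Y) (a : A)
    (z : Z) : moduleDefect γ α σ a z = α.act a (σ z) - σ (γ.act a z) := rfl

theorem isExtensionCocycle_moduleDefect (γ : LeftAction A Z) (α : LeftAction A Y)
    (σ : Z →L[ℂ] Y) : IsExtensionCocycle α γ (moduleDefect γ α σ) := fun a b z => by
  simp [α.mul_act, γ.mul_act]

end Extensions

section SecondCohomology

variable {A : Type u} [NonUnitalNormedRing A] [NormedSpace ℂ A] [IsScalarTower ℂ A A]
  [SMulCommClass ℂ A A] {X : Type u} [NormedAddCommGroup X] [NormedSpace ℂ X]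

@[simp]
theorem LeftAction.regular_act (a b : A) : (LeftAction.regular A).act a b = a * b := rfl

theorem BiAction.IsRightAnnihilator.delta2_eq_zero_iff {β : BiAction A X}
    (hβ : β.IsRightAnnihilator) (f : A →L[ℂ] A →L[ℂ] X) :
    β.delta2 f = 0 ↔ IsExtensionCocycle β.toLeftAction (.regular A) f := by
  have hiff (a b c : A) : β.delta2 f a b c = 0 ↔
      f (a * b) c = β.toLeftAction.act a (f b c) + f a ((LeftAction.regular A).act b c) := by
    rw [BiAction.delta2_apply, hβ, sub_zero, sub_add_eq_add_sub, sub_eq_zero, eq_comm]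
    rfl
  simp only [IsExtensionCocycle, ← hiff, ContinuousLinearMap.ext_iff, zero_apply]

theorem BiAction.IsRightAnnihilator.delta1_eq_moduleDefect {β : BiAction A X}
    (hβ : β.IsRightAnnihilator) (g : A →L[ℂ] X) :
    β.delta1 g = moduleDefect (.regular A) β.toLeftAction g := by
  ext a b
  rw [BiAction.delta1_apply, hβ, add_zero]
  rfl

theorem BiAction.IsRightAnnihilator.subsingleton_H2_iff {β : BiAction A X}
    (hβ : β.IsRightAnnihilator) :
    Subsingleton β.H2 ↔ ∀ f, IsExtensionCocycle β.toLeftAction (.regular A) f →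
      ∃ g, moduleDefect (.regular A) β.toLeftAction g = f := by
  simp only [← hβ.delta2_eq_zero_iff, ← hβ.delta1_eq_moduleDefect]
  rw [Submodule.Quotient.subsingleton_iff, eq_top_iff]
  exact ⟨fun h f hf => h (x := ⟨f, hf⟩) trivial, fun h f _ => h f.1 f.2⟩

theorem IsLeftProjective.exists_moduleDefect_eq [CompleteSpace A] [CompleteSpace X]
    (h : IsLeftProjective A) {α : LeftAction A X} {f : A →L[ℂ] A →L[ℂ] X}
    (hf : IsExtensionCocycle α (.regular A) f) : ∃ g, moduleDefect (.regular A) α g = f := by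
  obtain ⟨ψ, hψ, hsection⟩ := h (X × A) (.ofCocycle α (.regular A) hf) (.snd ℂ X A)
    (fun _ _ => rfl) ⟨.inr ℂ X A, rfl⟩
  have hsnd (a : A) : (ψ a).2 = a := DFunLike.congr_fun hsection a
  refine ⟨-(.fst ℂ X A ∘L ψ), ?_⟩
  ext a b
  have hfst : (ψ (a * b)).1 = α.act a (ψ b).1 + f a b := by
    simpa [hsnd] using congrArg Prod.fst (hψ a b)
  simp [hfst]

theorem IsLeftProjective.of_exists_moduleDefect_eq
    (h : ∀ (X : Type u) [NormedAddCommGroup X] [NormedSpace ℂ X] [CompleteSpace X]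
      (α : LeftAction A X) (f : A →L[ℂ] A →L[ℂ] X), IsExtensionCocycle α (.regular A) f →
      ∃ g, moduleDefect (.regular A) α g = f) : IsLeftProjective A := by
  intro Y _ _ _ αY φ hφ ⟨σ, hσ⟩
  have hφσ (a : A) : φ (σ a) = a := DFunLike.congr_fun hσ a
  have : CompleteSpace φ.ker := φ.isClosed_ker.completeSpace_coe
  have hinvariant (a : A) (y : Y) (hy : y ∈ φ.ker) : αY.act a y ∈ φ.ker := by
    rw [LinearMap.mem_ker] at hy ⊢
    exact (hφ a y).trans ((congrArg _ hy).trans (map_zero _))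
  let α := αY.restrict φ.ker hinvariant
  let f := codRestrict₂ (moduleDefect (.regular A) αY σ) φ.ker fun a b => by
    simp [hφ a (σ b), hφσ]
  obtain ⟨g, hg⟩ := h φ.ker α f fun a b c =>
    Subtype.ext (isExtensionCocycle_moduleDefect (.regular A) αY σ a b c)
  have hdefect (a b : A) : αY.act a (g b) - g (a * b) = αY.act a (σ b) - σ (a * b) :=
    congrArg Subtype.val (DFunLike.congr_fun (DFunLike.congr_fun hg a) b)
  refine ⟨σ - φ.ker.subtypeL ∘L g, fun a b => ?_, ?_⟩
  · change σ (a * b) - g (a * b) = αY.act a (σ b - g b)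
    rw [map_sub, sub_eq_sub_iff_sub_eq_sub, ← neg_sub, ← hdefect, neg_sub]
  · ext b
    have hg : φ (g b) = 0 := (g b).2
    simp [hφσ, hg]

theorem isLeftProjective_iff_subsingleton_H2 [CompleteSpace A] :
    IsLeftProjective A ↔ ∀ (X : Type u) [NormedAddCommGroup X] [NormedSpace ℂ X] [CompleteSpace X]
      (β : BiAction A X), β.IsRightAnnihilator → Subsingleton β.H2 := by
  refine ⟨fun h X _ _ _ β hβ => hβ.subsingleton_H2_iff.2 fun f => h.exists_moduleDefect_eq,
    fun h => .of_exists_moduleDefect_eq fun X _ _ _ α f => ?_⟩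
  exact (BiAction.isRightAnnihilator_ofLeft α).subsingleton_H2_iff.1
    (h X _ (BiAction.isRightAnnihilator_ofLeft α)) f

end SecondCohomology

section LeftProjective

open scoped BoundedContinuousFunction

section GelfandTransform

variable (A : Type u) [NonUnitalNormedRing A] [NormedSpace ℂ A]

/-- The Gelfand transform `a ↦ (χ ↦ χ a)` of a possibly non-unital normed algebra, as a bounded
linear map into the bounded continuous functions on the spectrum. -/
noncomputable def gelfandCLM : A →L[ℂ] (characterSpace ℂ A →ᵇ ℂ) :=
  LinearMap.mkContinuous
    { toFun a := .ofNormedAddCommGroup (fun χ => χ a) (continuous_eval_character a) ‖a‖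
        fun χ => norm_character_le χ a
      map_add' a b := by ext χ; exact map_add χ a b
      map_smul' c a := by ext χ; exact map_smul χ c a } 1 fun a => by
    rw [one_mul]
    exact BoundedContinuousFunction.norm_ofNormedAddCommGroup_le _ (norm_nonneg a)
      fun χ => norm_character_le χ a

variable {A}

variable (A) in
/-- The left module of bounded continuous functions `F : Â → A` with `(a · F) χ = χ a • F χ`. -/
noncomputable def gelfandAction : LeftAction A (characterSpace ℂ A →ᵇ A) where
  act :=
    have : IsScalarTower ℂ (characterSpace ℂ A →ᵇ ℂ) (characterSpace ℂ A →ᵇ A) :=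
      ⟨fun c f F => by ext χ; exact smul_assoc c (f χ) (F χ)⟩
    ContinuousLinearMap.lsmul ℂ (characterSpace ℂ A →ᵇ ℂ) ∘L gelfandCLM A
  mul_act a b F := by
    ext χ
    exact (congrArg (· • F χ) (map_mul χ a b)).trans (mul_smul (χ a) (χ b) (F χ))

@[simp]
theorem gelfandAction_apply (a : A) (F : characterSpace ℂ A →ᵇ A) (χ : characterSpace ℂ A) :
    (gelfandAction A).act a F χ = χ a • F χ := rfl

variable (A) in
/-- The pairs of a function `F : Â → A` and an element `a` of `A` whose Gelfand transform is the
restriction of `F`, read as a function of two characters, to the diagonal. -/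
def diagonalSubmodule : Submodule ℂ ((characterSpace ℂ A →ᵇ A) × A) where
  carrier := {p | ∀ χ : characterSpace ℂ A, χ (p.1 χ) = χ p.2}
  add_mem' hp hq χ := by simp [hp χ, hq χ]
  zero_mem' χ := by simp
  smul_mem' c p hp χ := by simp [hp χ]

theorem isClosed_diagonalSubmodule :
    IsClosed (diagonalSubmodule A : Set ((characterSpace ℂ A →ᵇ A) × A)) := by
  have hinter : (diagonalSubmodule A : Set ((characterSpace ℂ A →ᵇ A) × A)) =
      ⋂ χ : characterSpace ℂ A, {p | χ (p.1 χ) = χ p.2} := by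
    ext p
    simp [diagonalSubmodule]
  rw [hinter]
  exact isClosed_iInter fun χ => isClosed_eq
    ((map_continuous χ).comp ((continuous_eval_const χ).comp continuous_fst))
    ((map_continuous χ).comp continuous_snd)

variable [IsScalarTower ℂ A A] [SMulCommClass ℂ A A]

variable (A) in
/-- The left module structure on `diagonalSubmodule A`. -/
noncomputable def diagonalAction : LeftAction A (diagonalSubmodule A) :=
  ((gelfandAction A).prod (.regular A)).restrict (diagonalSubmodule A) fun a p hp χ => by
    simp [hp χ]

theorem diagonalAction_fst (a : A) (p : diagonalSubmodule A) (χ : characterSpace ℂ A) :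
    ((diagonalAction A).act a p).1.1 χ = χ a • p.1.1 χ :=
  congrArg (fun q => q.1 χ) (LeftAction.prod_act (gelfandAction A) (.regular A) a p.1)

theorem IsLeftProjective.exists_diagonal_section [CompleteSpace A] (h : IsLeftProjective A) :
    ∃ Ψ : A → (characterSpace ℂ A →ᵇ A), (∀ a, ∀ χ : characterSpace ℂ A, χ (Ψ a χ) = χ a) ∧
      ∀ a b, ∀ χ : characterSpace ℂ A, Ψ (a * b) χ = χ a • Ψ b χ := by
  have : CompleteSpace (diagonalSubmodule A) := isClosed_diagonalSubmodule.completeSpace_coe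
  let φ : diagonalSubmodule A →L[ℂ] A := .snd ℂ _ A ∘L (diagonalSubmodule A).subtypeL
  let σ : A →L[ℂ] diagonalSubmodule A := LinearMap.mkContinuous
    { toFun a := ⟨(.const _ a, a), fun _ => rfl⟩
      map_add' _ _ := rfl
      map_smul' _ _ := rfl } 1 fun a => by
    rw [one_mul]
    exact max_le (BoundedContinuousFunction.norm_const_le a) le_rfl
  obtain ⟨ψ, hψ, hsection⟩ := h (diagonalSubmodule A) (diagonalAction A) φ (fun _ _ => rfl)
    ⟨σ, rfl⟩
  refine ⟨fun a => (ψ a).1.1, fun a χ => ?_, fun a b χ => ?_⟩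
  · rw [(ψ a).2 χ]
    exact congrArg χ (DFunLike.congr_fun hsection a)
  · rw [← diagonalAction_fst, ← hψ]
    rfl

end GelfandTransform

variable {A : Type u} [NonUnitalNormedCommRing A] [NormedSpace ℂ A] [IsScalarTower ℂ A A]
  [SMulCommClass ℂ A A] [CompleteSpace A]

theorem IsLeftProjective.exists_continuous_eval_eq_one (h : IsLeftProjective A) :
    ∃ G : characterSpace ℂ A → A, Continuous G ∧ ∀ χ : characterSpace ℂ A, χ (G χ) = 1 := by
  obtain ⟨Ψ, hdiag, hmul⟩ := h.exists_diagonal_section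
  have hcomm (a b : A) (χ : characterSpace ℂ A) : χ a • Ψ b χ = χ b • Ψ a χ := by
    rw [← hmul, mul_comm, hmul]
  choose b hb using exists_character_ne_zero (𝕜 := ℂ) (A := A)
  refine ⟨fun χ => (χ (b χ))⁻¹ • Ψ (b χ) χ, ?_, fun χ => ?_⟩
  · refine continuous_iff_continuousAt.2 fun χ => ?_
    have hlocal : ContinuousAt (fun χ' => (χ' (b χ))⁻¹ • Ψ (b χ) χ') χ :=
      ((continuous_eval_character (b χ)).continuousAt.inv₀ (hb χ)).smul
        (Ψ (b χ)).continuous.continuousAt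
    refine hlocal.congr ?_
    filter_upwards [(continuous_eval_character (b χ)).continuousAt.eventually_ne (hb χ)]
      with χ' hχ'
    rw [inv_smul_eq_iff₀ hχ', smul_comm, eq_inv_smul_iff₀ (hb χ'), hcomm]
  · rw [map_smul, hdiag, smul_eq_mul, inv_mul_cancel₀ (hb χ)]

theorem SuslinCondition.sigmaCompactSpace_of_isLeftProjective
    (hA : SuslinCondition (characterSpace ℂ A)) (h : IsLeftProjective A) :
    SigmaCompactSpace (characterSpace ℂ A) := by
  obtain ⟨G, hG, hone⟩ := h.exists_continuous_eval_eq_one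
  refine hA.sigmaCompactSpace_of_continuous hG one_half_pos fun χ =>
    ⟨_, isCompact_character_ge (G χ) one_half_pos, fun χ' hdist => ?_⟩
  have hclose : ‖1 - χ' (G χ)‖ < 1 / 2 := by
    rw [← hone χ', ← map_sub]
    exact (norm_character_le χ' _).trans_lt (by rwa [← dist_eq_norm])
  have htriangle := norm_sub_norm_le (1 : ℂ) (χ' (G χ))
  rw [norm_one] at htriangle
  change 1 / 2 ≤ ‖χ' (G χ)‖
  linarith

end LeftProjective

section GelfandDuality

variable {A : Type*} [NonUnitalCommCStarAlgebra A]

instance instStarHomClassCharacterSpace : StarHomClass (characterSpace ℂ A) A ℂ where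
  map_star χ a := by
    let ψ : Unitization ℂ A →ₐ[ℂ] ℂ := Unitization.lift (CharacterSpace.toNonUnitalAlgHom χ)
    have hψ (b : A) : ψ (b : Unitization ℂ A) = χ b := by simp [ψ]
    have := AlgHomClass.instStarHomClass (F := Unitization ℂ A →ₐ[ℂ] ℂ) (A := Unitization ℂ A)
    rw [← hψ, ← hψ, Unitization.inr_star, map_star]

theorem norm_le_of_forall_character {a : A} {c : ℝ} (hc : 0 ≤ c)
    (h : ∀ χ : characterSpace ℂ A, ‖χ a‖ ≤ c) : ‖a‖ ≤ c := by
  rw [← Unitization.norm_inr (𝕜 := ℂ) a,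
    ← (gelfandTransform_isometry (Unitization ℂ A)).norm_map_of_map_zero (map_zero _),
    ContinuousMap.norm_le _ hc]
  intro ψ
  let ρ : WeakDual ℂ A := StrongDual.toWeakDual ((CharacterSpace.toCLM ψ).comp
    (LinearMap.mkContinuous (Unitization.inrHom ℂ ℂ A) 1 fun x => by simp [Unitization.norm_inr]))
  have hρ (x : A) : ρ x = ψ (x : Unitization ℂ A) := rfl
  change ‖ρ a‖ ≤ c
  rcases eq_or_ne ρ 0 with hzero | hne
  · rw [hzero]
    exact norm_zero.trans_le hc
  · exact h ⟨ρ, hne, fun x y => by simp [hρ, Unitization.inr_mul]⟩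

theorem eq_of_forall_character {a b : A} (h : ∀ χ : characterSpace ℂ A, χ a = χ b) : a = b := by
  rw [← sub_eq_zero, ← norm_le_zero_iff]
  exact norm_le_of_forall_character le_rfl fun χ => by simp [h]

theorem character_cfcₙ (χ : characterSpace ℂ A) {f : ℝ → ℝ} (hf : Continuous f) (hf0 : f 0 = 0)
    {a : A} (ha : IsSelfAdjoint a) : χ (cfcₙ f a) = f (χ a).re := by
  have hχa : IsSelfAdjoint (χ a) := ha.map χ
  have hre : χ a = algebraMap ℝ ℂ (χ a).re := (Complex.conj_eq_iff_re.1 hχa).symm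
  let φ : A →⋆ₙₐ[ℂ] ℂ := χ
  have hmap : χ (cfcₙ f a) = cfcₙ f (χ a) :=
    NonUnitalStarAlgHom.map_cfcₙ φ f a hf.continuousOn hf0 (map_continuous χ) ha hχa
  rw [hmap, cfcₙ_eq_cfc (hf := hf.continuousOn) (hf0 := hf0), hre, cfc_algebraMap]
  rfl

variable [PartialOrder A] [StarOrderedRing A]

theorem nonneg_iff_forall_character {a : A} : 0 ≤ a ↔ ∀ χ : characterSpace ℂ A, 0 ≤ χ a := by
  refine ⟨fun ha χ => map_nonneg χ ha, fun h => ?_⟩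
  have ha : IsSelfAdjoint a := eq_of_forall_character fun χ => by
    rw [map_star, (IsSelfAdjoint.of_nonneg (h χ)).star_eq]
  have habs : a = cfcₙ (fun t : ℝ => |t|) a := eq_of_forall_character fun χ => by
    rw [character_cfcₙ χ continuous_abs abs_zero ha, abs_of_nonneg (Complex.nonneg_iff.1 (h χ)).1]
    exact (Complex.conj_eq_iff_re.1 (IsSelfAdjoint.of_nonneg (h χ))).symm
  rw [habs]
  exact cfcₙ_nonneg fun x _ => abs_nonneg x

theorem le_iff_forall_character {a b : A} :
    a ≤ b ↔ ∀ χ : characterSpace ℂ A, χ a ≤ χ b := by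
  rw [← sub_nonneg, nonneg_iff_forall_character]
  simp only [map_sub, sub_nonneg]

end GelfandDuality

section SignAverage

variable {𝕜 E F Y ι : Type*} [RCLike 𝕜] [NormedAddCommGroup E] [NormedSpace 𝕜 E]
  [NormedAddCommGroup F] [NormedSpace 𝕜 F] [NormedAddCommGroup Y] [NormedSpace 𝕜 Y]

theorem norm_add_smul_add_sum_smul_le [DecidableEq ι] {k : ι} {s : Finset ι} (hk : k ∉ s) {x₀ : E}
    {x : ι → E} {P : ℝ} (hx : ∀ ε : ι → ℤˣ, ‖x₀ + ∑ i ∈ insert k s, ε i • x i‖ ≤ P) (η : ℤˣ)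
    (ε : ι → ℤˣ) : ‖x₀ + η • x k + ∑ i ∈ s, ε i • x i‖ ≤ P := by
  have hsum : ∑ i ∈ insert k s, Function.update ε k η i • x i = η • x k + ∑ i ∈ s, ε i • x i := by
    rw [Finset.sum_insert hk, Function.update_self]
    congr 1
    exact Finset.sum_congr rfl fun i hi => by
      rw [Function.update_of_ne (ne_of_mem_of_not_mem hi hk)]
  rw [add_assoc, ← hsum]
  exact hx _

theorem norm_add_sum_bilinear_le (B : E →L[𝕜] F →L[𝕜] Y) (x : ι → E) (y : ι → F) {P Q : ℝ}
    (s : Finset ι) (x₀ : E) (y₀ : F)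
    (hx : ∀ ε : ι → ℤˣ, ‖x₀ + ∑ i ∈ s, ε i • x i‖ ≤ P)
    (hy : ∀ ε : ι → ℤˣ, ‖y₀ + ∑ i ∈ s, ε i • y i‖ ≤ Q) :
    ‖B x₀ y₀ + ∑ i ∈ s, B (x i) (y i)‖ ≤ ‖B‖ * P * Q := by
  classical
  induction s using Finset.induction_on generalizing x₀ y₀ with
  | empty =>
    simp only [Finset.sum_empty, add_zero] at hx hy ⊢
    exact B.le_of_opNorm₂_le_of_le le_rfl (hx 1) (hy 1)
  | insert k s hk ih =>
    let T (η : ℤˣ) : Y := B (x₀ + η • x k) (y₀ + η • y k) + ∑ i ∈ s, B (x i) (y i)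
    have hT (η : ℤˣ) : ‖T η‖ ≤ ‖B‖ * P * Q := ih _ _
      (norm_add_smul_add_sum_smul_le hk hx η) (norm_add_smul_add_sum_smul_le hk hy η)
    have haverage : (2 : 𝕜) • (B x₀ y₀ + ∑ i ∈ insert k s, B (x i) (y i)) = T 1 + T (-1) := by
      simp only [T, Finset.sum_insert hk, one_smul, Units.neg_smul, map_add, map_neg, add_apply,
        neg_apply, two_smul]
      abel
    have hnorm := (congrArg norm haverage).trans_le (norm_add_le_of_le (hT 1) (hT (-1)))
    rw [norm_smul, RCLike.norm_two] at hnorm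
    linarith

/-- The cross terms of `B (∑ ε i • x i) (∑ ε i • y i)` cancel in the average over all signs `ε`. -/
theorem norm_sum_bilinear_le (B : E →L[𝕜] F →L[𝕜] Y) (x : ι → E) (y : ι → F) {P Q : ℝ}
    (s : Finset ι) (hx : ∀ ε : ι → ℤˣ, ‖∑ i ∈ s, ε i • x i‖ ≤ P)
    (hy : ∀ ε : ι → ℤˣ, ‖∑ i ∈ s, ε i • y i‖ ≤ Q) :
    ‖∑ i ∈ s, B (x i) (y i)‖ ≤ ‖B‖ * P * Q := by
  simpa using norm_add_sum_bilinear_le B x y s 0 0 (by simpa using hx) (by simpa using hy)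

variable {A : Type*} [NonUnitalCommCStarAlgebra A]

theorem norm_sum_smul_le_of_forall_character {x : ι → A} {s : Finset ι} {P : ℝ} (hP : 0 ≤ P)
    (hx : ∀ χ : characterSpace ℂ A, ∑ i ∈ s, ‖χ (x i)‖ ≤ P) (ε : ι → ℤˣ) :
    ‖∑ i ∈ s, ε i • x i‖ ≤ P := by
  refine norm_le_of_forall_character hP fun χ => le_trans ?_ (hx χ)
  rw [map_sum]
  refine norm_sum_le_of_le s fun i _ => le_of_eq ?_
  rcases Int.units_eq_one_or (ε i) with h | h <;> simp [h]

end SignAverage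

section AlmostIdempotent

variable {A : Type u} [NonUnitalCommCStarAlgebra A] [PartialOrder A]

/-- An almost idempotent sequential approximate unit: it consists of positive contractions, and
each of its members acts as the identity on the preceding one. -/
structure IsAlmostIdempotentApproxUnit (e : ℕ → A) : Prop where
  nonneg : ∀ n, 0 ≤ e n
  mul_succ : ∀ n, e n * e (n + 1) = e n
  isSeqApproxIdentity : IsSeqApproxIdentityBoundedByOne e

namespace IsAlmostIdempotentApproxUnit

variable {e : ℕ → A}

theorem mul_of_lt (he : IsAlmostIdempotentApproxUnit e) {m n : ℕ} (hmn : m < n) :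
    e m * e n = e m := by
  induction n, hmn using Nat.le_induction with
  | base => exact he.mul_succ m
  | succ n hmn ih => rw [← ih, mul_assoc, he.mul_succ n]

theorem sub_mul_sub (he : IsAlmostIdempotentApproxUnit e) (n : ℕ) :
    (e (n + 2) - e (n + 1)) * (e (n + 3) - e n) = e (n + 2) - e (n + 1) := by
  have hcomm : e (n + 2) * e n = e (n + 1) * e n := by
    rw [mul_comm, he.mul_of_lt (by lia), mul_comm, he.mul_of_lt (by lia)]
  rw [mul_sub, sub_mul, sub_mul, hcomm, sub_self, sub_zero, he.mul_of_lt (by lia),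
    he.mul_of_lt (by lia)]

theorem norm_character_le_one (he : IsAlmostIdempotentApproxUnit e) (χ : characterSpace ℂ A)
    (n : ℕ) : ‖χ (e n)‖ ≤ 1 :=
  (norm_character_le χ (e n)).trans (he.isSeqApproxIdentity.1 n)

theorem tendsto_mul (he : IsAlmostIdempotentApproxUnit e) (b : A) :
    Tendsto (fun n => b * e n) atTop (𝓝 b) :=
  (he.isSeqApproxIdentity.2.tendsto_mul_left b).comp tendsto_map

theorem monotone_norm_character (he : IsAlmostIdempotentApproxUnit e) (χ : characterSpace ℂ A) :
    Monotone fun n => ‖χ (e n)‖ := by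
  refine monotone_nat_of_le_succ fun n => ?_
  have hmul : ‖χ (e n)‖ * ‖χ (e (n + 1))‖ = ‖χ (e n)‖ := by
    rw [← norm_mul, ← map_mul, he.mul_succ]
  rcases mul_right_eq_self₀.1 hmul with h | h
  · rw [h]; exact he.norm_character_le_one χ n
  · rw [h]; exact norm_nonneg _

variable [StarOrderedRing A]

theorem norm_character_sub (he : IsAlmostIdempotentApproxUnit e) (χ : characterSpace ℂ A)
    {m n : ℕ} (hmn : m ≤ n) : ‖χ (e n - e m)‖ = ‖χ (e n)‖ - ‖χ (e m)‖ := by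
  have hnorm (k : ℕ) : χ (e k) = (‖χ (e k)‖ : ℂ) :=
    Complex.eq_coe_norm_of_nonneg (map_nonneg χ (he.nonneg k))
  rw [map_sub, hnorm, hnorm m, ← Complex.ofReal_sub, Complex.norm_real, Real.norm_of_nonneg
    (sub_nonneg.2 (he.monotone_norm_character χ hmn)), ← hnorm, ← hnorm]

end IsAlmostIdempotentApproxUnit

theorem sum_succ_sub_le_of_monotone {x : ℕ → ℝ} (hx : Monotone x) {c : ℝ} (hc : ∀ n, x n ≤ c)
    {N : ℕ} {s : Finset ℕ} (hs : ∀ n ∈ s, N ≤ n) : ∑ n ∈ s, (x (n + 1) - x n) ≤ c - x N := by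
  obtain ⟨M, hM⟩ := s.exists_nat_subset_range
  calc ∑ n ∈ s, (x (n + 1) - x n) ≤ ∑ n ∈ Finset.Ico N (N + M), (x (n + 1) - x n) := by
        refine Finset.sum_le_sum_of_subset_of_nonneg (fun n hn => ?_)
          fun n _ _ => sub_nonneg.2 (hx n.le_succ)
        exact Finset.mem_Ico.2 ⟨hs n hn, (Finset.mem_range.1 (hM hn)).trans_le (by lia)⟩
    _ = x (N + M) - x N := Finset.sum_Ico_sub x (by lia)
    _ ≤ c - x N := sub_le_sub_right (hc _) _

namespace IsAlmostIdempotentApproxUnit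

variable [StarOrderedRing A] {e : ℕ → A}

theorem sum_norm_character_mul_succ_sub_le (he : IsAlmostIdempotentApproxUnit e) (b : A) {N : ℕ}
    {s : Finset ℕ} (hs : ∀ n ∈ s, N ≤ n) (χ : characterSpace ℂ A) :
    ∑ n ∈ s, ‖χ (b * (e (n + 2) - e (n + 1)))‖ ≤ ‖b - b * e (N + 1)‖ := by
  calc ∑ n ∈ s, ‖χ (b * (e (n + 2) - e (n + 1)))‖
      = ‖χ b‖ * ∑ n ∈ s, (‖χ (e (n + 2))‖ - ‖χ (e (n + 1))‖) := by
        rw [Finset.mul_sum]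
        exact Finset.sum_congr rfl fun n _ => by
          rw [map_mul, norm_mul, he.norm_character_sub χ (by lia)]
    _ ≤ ‖χ b‖ * (1 - ‖χ (e (N + 1))‖) := by
        gcongr
        exact sum_succ_sub_le_of_monotone (x := fun n => ‖χ (e (n + 1))‖)
          (fun m n h => he.monotone_norm_character χ (by lia))
          (fun n => he.norm_character_le_one χ _) hs
    _ = ‖χ b‖ - ‖χ (b * e (N + 1))‖ := by rw [map_mul, norm_mul, mul_one_sub]
    _ ≤ ‖χ (b - b * e (N + 1))‖ := by rw [map_sub]; exact norm_sub_norm_le _ _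
    _ ≤ ‖b - b * e (N + 1)‖ := norm_character_le χ _

theorem sum_norm_character_add_three_sub_le (he : IsAlmostIdempotentApproxUnit e) (s : Finset ℕ)
    (χ : characterSpace ℂ A) : ∑ n ∈ s, ‖χ (e (n + 3) - e n)‖ ≤ 3 := by
  have hshift (k : ℕ) : ∑ n ∈ s, (‖χ (e (n + 1 + k))‖ - ‖χ (e (n + k))‖) ≤ 1 :=
    (sum_succ_sub_le_of_monotone (x := fun n => ‖χ (e (n + k))‖)
      (fun m n h => he.monotone_norm_character χ (by lia))
      (fun n => he.norm_character_le_one χ _) (fun n _ => n.zero_le)).trans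
      (sub_le_self _ (norm_nonneg _))
  calc ∑ n ∈ s, ‖χ (e (n + 3) - e n)‖
      = ∑ n ∈ s, (‖χ (e (n + 1))‖ - ‖χ (e n)‖)
        + ∑ n ∈ s, (‖χ (e (n + 1 + 1))‖ - ‖χ (e (n + 1))‖)
        + ∑ n ∈ s, (‖χ (e (n + 1 + 2))‖ - ‖χ (e (n + 2))‖) := by
        rw [← Finset.sum_add_distrib, ← Finset.sum_add_distrib]
        exact Finset.sum_congr rfl fun n _ => by
          rw [he.norm_character_sub χ (by lia)]; ring
    _ ≤ 1 + 1 + 1 := add_le_add_three (hshift 0) (hshift 1) (hshift 2)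
    _ = 3 := by norm_num

variable {Y : Type*} [NormedAddCommGroup Y] [NormedSpace ℂ Y]

theorem summable_bilinear [CompleteSpace Y] (he : IsAlmostIdempotentApproxUnit e)
    (B : A →L[ℂ] A →L[ℂ] Y) (b : A) :
    Summable fun n => B (b * (e (n + 2) - e (n + 1))) (e (n + 3) - e n) := by
  rw [summable_iff_vanishing_norm]
  intro ε hε
  have hlim : Tendsto (fun N => ‖B‖ * ‖b - b * e (N + 1)‖ * 3) atTop (𝓝 0) := by
    have hunit := (he.tendsto_mul b).comp (tendsto_add_atTop_nat 1)
    simpa using! ((hunit.const_sub b).norm.const_mul ‖B‖).mul_const 3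
  obtain ⟨N, hN⟩ := (hlim.eventually_lt_const hε).exists
  refine ⟨Finset.range N, fun t ht => lt_of_le_of_lt ?_ hN⟩
  have htail (n : ℕ) (hn : n ∈ t) : N ≤ n :=
    not_lt.1 fun h => Finset.disjoint_left.1 ht hn (Finset.mem_range.2 h)
  exact norm_sum_bilinear_le B _ _ t
    (norm_sum_smul_le_of_forall_character (norm_nonneg _)
      (he.sum_norm_character_mul_succ_sub_le b htail))
    (norm_sum_smul_le_of_forall_character zero_le_three
      (he.sum_norm_character_add_three_sub_le t))

end IsAlmostIdempotentApproxUnit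

end AlmostIdempotent

section PartialLift

variable {A : Type u} [NonUnitalNormedRing A] [NormedSpace ℂ A] [IsScalarTower ℂ A A]
  [SMulCommClass ℂ A A] {Y : Type u} [NormedAddCommGroup Y] [NormedSpace ℂ Y]

/-- The morphism `b ↦ (b * u) · y` of left modules. -/
noncomputable def LeftAction.mulOrbit (α : LeftAction A Y) (u : A) (y : Y) : A →L[ℂ] Y :=
  (α.act.flip y).comp ((ContinuousLinearMap.mul ℂ A).flip u)

theorem LeftAction.mulOrbit_apply (α : LeftAction A Y) (u : A) (y : Y) (b : A) :
    α.mulOrbit u y b = α.act (b * u) y := rfl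

/-- The partial sums of the lift to `Y` of the telescoping decomposition
`b = b * e 1 + ∑ b * (e (n + 2) - e (n + 1))`. -/
noncomputable def LeftAction.partialLift (α : LeftAction A Y) (σ : A →L[ℂ] Y) (e : ℕ → A)
    (N : ℕ) : A →L[ℂ] Y :=
  α.mulOrbit (e 1) (σ (e 2)) +
    ∑ n ∈ Finset.range N, α.mulOrbit (e (n + 2) - e (n + 1)) (σ (e (n + 3) - e n))

theorem LeftAction.partialLift_apply (α : LeftAction A Y) (σ : A →L[ℂ] Y) (e : ℕ → A) (N : ℕ)
    (b : A) : α.partialLift σ e N b = α.act (b * e 1) (σ (e 2)) +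
      ∑ n ∈ Finset.range N, α.act (b * (e (n + 2) - e (n + 1))) (σ (e (n + 3) - e n)) := by
  simp only [partialLift, add_apply, sum_apply, mulOrbit_apply]

theorem LeftAction.isModuleHom_partialLift (α : LeftAction A Y) (σ : A →L[ℂ] Y) (e : ℕ → A)
    (N : ℕ) : IsModuleHom (LeftAction.regular A) α (α.partialLift σ e N) := fun a b => by
  simp only [regular_act, partialLift_apply, mul_assoc, α.mul_act, map_add, map_sum]

end PartialLift

section Projectivity

variable {A : Type u} [NonUnitalCommCStarAlgebra A] [PartialOrder A] {e : ℕ → A} {Y : Type u}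
  [NormedAddCommGroup Y] [NormedSpace ℂ Y] {α : LeftAction A Y}

namespace IsAlmostIdempotentApproxUnit

theorem map_partialLift (he : IsAlmostIdempotentApproxUnit e) {φ : Y →L[ℂ] A}
    (hφ : IsModuleHom α (LeftAction.regular A) φ) {σ : A →L[ℂ] Y}
    (hσ : φ.comp σ = ContinuousLinearMap.id ℂ A) (N : ℕ) (b : A) :
    φ (α.partialLift σ e N b) = b * e (N + 1) := by
  have hφσ (a v : A) : φ (α.act a (σ v)) = a * v := by
    rw [hφ, LeftAction.regular_act]
    exact congrArg (a * ·) (DFunLike.congr_fun hσ v)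
  simp only [LeftAction.partialLift_apply, map_add, map_sum, hφσ, mul_assoc, he.sub_mul_sub,
    he.mul_succ]
  rw [← Finset.mul_sum, Finset.sum_range_sub fun n => e (n + 1), mul_sub, add_sub_cancel]

variable [StarOrderedRing A] [CompleteSpace Y]

theorem exists_tendsto_partialLift (he : IsAlmostIdempotentApproxUnit e) (α : LeftAction A Y)
    (σ : A →L[ℂ] Y) :
    ∃ ψ : A →L[ℂ] Y, ∀ b, Tendsto (fun N => α.partialLift σ e N b) atTop (𝓝 (ψ b)) := by
  let B : A →L[ℂ] A →L[ℂ] Y := α.act.bilinearComp (.id ℂ A) σ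
  have hlim : Tendsto (fun N b => α.partialLift σ e N b) atTop (𝓝 fun b =>
      α.act (b * e 1) (σ (e 2)) + ∑' n, B (b * (e (n + 2) - e (n + 1))) (e (n + 3) - e n)) := by
    refine tendsto_pi_nhds.2 fun b => ?_
    simp only [LeftAction.partialLift_apply]
    exact (he.summable_bilinear B b).hasSum.tendsto_sum_nat.const_add _
  exact ⟨continuousLinearMapOfTendsto _ hlim, tendsto_pi_nhds.1 hlim⟩

theorem isLeftProjective (he : IsAlmostIdempotentApproxUnit e) : IsLeftProjective A := by
  intro Y _ _ _ α φ hφ ⟨σ, hσ⟩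
  obtain ⟨ψ, hψ⟩ := he.exists_tendsto_partialLift α σ
  refine ⟨ψ, fun a b => ?_, ?_⟩
  · refine tendsto_nhds_unique (hψ (a * b)) ?_
    exact (((α.act a).continuous.tendsto _).comp (hψ b)).congr fun N =>
      (α.isModuleHom_partialLift σ e N a b).symm
  · ext b
    refine tendsto_nhds_unique ((φ.continuous.tendsto _).comp (hψ b)) ?_
    exact ((he.tendsto_mul b).comp (tendsto_add_atTop_nat 1)).congr fun N =>
      (he.map_partialLift hφ hσ N b).symm

end IsAlmostIdempotentApproxUnit

end Projectivity

section Cutoff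

/-- The piecewise linear cutoff equal to `0` for `t ≤ 2⁻ⁿ` and to `1` for `t ≥ 2 * 2⁻ⁿ`. -/
noncomputable def cutoff (n : ℕ) (t : ℝ) : ℝ := max 0 (min 1 (2 ^ n * t - 1))

theorem continuous_cutoff (n : ℕ) : Continuous (cutoff n) := by
  unfold cutoff
  fun_prop

theorem cutoff_nonneg (n : ℕ) (t : ℝ) : 0 ≤ cutoff n t := le_max_left _ _

theorem cutoff_le_one (n : ℕ) (t : ℝ) : cutoff n t ≤ 1 := max_le zero_le_one (min_le_left _ _)

theorem cutoff_le_mul (n : ℕ) {t : ℝ} (ht : 0 ≤ t) : cutoff n t ≤ 2 ^ n * t :=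
  max_le (by positivity) ((min_le_right _ _).trans (sub_le_self _ zero_le_one))

theorem cutoff_of_le {n : ℕ} {t : ℝ} (h : 2 ^ n * t ≤ 1) : cutoff n t = 0 :=
  max_eq_left ((min_le_right _ _).trans (sub_nonpos.2 h))

theorem cutoff_of_ge {n : ℕ} {t : ℝ} (h : 2 ≤ 2 ^ n * t) : cutoff n t = 1 := by
  rw [cutoff, min_eq_left (by linarith), max_eq_right zero_le_one]

theorem cutoff_zero_right (n : ℕ) : cutoff n 0 = 0 := cutoff_of_le (by simp)

theorem cutoff_mul_cutoff_succ (n : ℕ) (t : ℝ) : cutoff n t * cutoff (n + 1) t = cutoff n t := by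
  rcases le_total (2 ^ n * t) 1 with h | h
  · rw [cutoff_of_le h, zero_mul]
  · rw [cutoff_of_ge (n := n + 1) (by rw [pow_succ]; linarith), mul_one]

theorem eventually_two_le_two_pow_mul {t : ℝ} (ht : 0 < t) : ∀ᶠ n : ℕ in atTop, 2 ≤ 2 ^ n * t :=
  ((tendsto_pow_atTop_atTop_of_one_lt one_lt_two).atTop_mul_const ht).eventually_ge_atTop 2

end Cutoff

section PositiveOnCharacters

variable {A : Type u} [NonUnitalCommCStarAlgebra A] {a : A}

/-- The Gelfand transform of `a` is strictly positive everywhere; by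
`strictlyPositiveElement_iff_isPositiveOnCharacters` this is strict positivity of `a`. -/
def IsPositiveOnCharacters (a : A) : Prop := ∀ χ : characterSpace ℂ A, 0 < χ a

theorem IsPositiveOnCharacters.sigmaCompactSpace (h : IsPositiveOnCharacters a) :
    SigmaCompactSpace (characterSpace ℂ A) :=
  sigmaCompactSpace_characterSpace_iff.2 ⟨fun _ => a, fun χ => ⟨0, (h χ).ne'⟩⟩

theorem IsPositiveOnCharacters.eventually_two_le (h : IsPositiveOnCharacters a) (b : A) {ε : ℝ}
    (hε : 0 < ε) :
    ∀ᶠ n : ℕ in atTop, ∀ χ : characterSpace ℂ A, ε ≤ ‖χ b‖ → 2 ≤ 2 ^ n * (χ a).re := by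
  rcases {χ : characterSpace ℂ A | ε ≤ ‖χ b‖}.eq_empty_or_nonempty with hempty | hne
  · exact .of_forall fun n χ hχ => (Set.notMem_empty χ (hempty.subset hχ)).elim
  · obtain ⟨χ₀, -, hmin⟩ := (isCompact_character_ge b hε).exists_isMinOn hne
      (Complex.continuous_re.comp (continuous_eval_character a)).continuousOn
    filter_upwards [eventually_two_le_two_pow_mul (Complex.pos_iff.1 (h χ₀)).1] with n hn χ hχ
    exact hn.trans (mul_le_mul_of_nonneg_left (hmin hχ) (by positivity))

theorem exists_pos_summable_smul (𝕜 : Type*) {E : Type*} [RCLike 𝕜] [NormedAddCommGroup E]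
    [NormedSpace 𝕜 E] [CompleteSpace E] (x : ℕ → E) :
    ∃ r : ℕ → ℝ, (∀ n, 0 < r n) ∧ Summable fun n => (r n : 𝕜) • x n := by
  refine ⟨fun n => (1 / 2) ^ n * (1 + ‖x n‖)⁻¹, fun n => by positivity,
    .of_norm_bounded summable_geometric_two fun n => ?_⟩
  rw [norm_smul, RCLike.norm_of_nonneg (by positivity), mul_assoc]
  refine mul_le_of_le_one_right (by positivity) ?_
  rw [inv_mul_le_one₀ (by positivity)]
  linarith

theorem exists_isPositiveOnCharacters [SigmaCompactSpace (characterSpace ℂ A)] :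
    ∃ a : A, IsPositiveOnCharacters a := by
  obtain ⟨e, he⟩ := sigmaCompactSpace_characterSpace_iff.1 ‹SigmaCompactSpace (characterSpace ℂ A)›
  obtain ⟨r, hr, hsum⟩ := exists_pos_summable_smul ℂ fun n => star (e n) * e n
  refine ⟨∑' n, (r n : ℂ) • (star (e n) * e n), fun χ => ?_⟩
  have hχsum : HasSum (fun n => (r n : ℂ) * (star (χ (e n)) * χ (e n)))
      (χ (∑' n, (r n : ℂ) • (star (e n) * e n))) := by
    simpa only [Function.comp_def, map_smul, map_mul, map_star, smul_eq_mul] using!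
      hsum.hasSum.map χ (map_continuous χ)
  have hr' (n : ℕ) : (0 : ℂ) < r n := Complex.zero_lt_real.2 (hr n)
  obtain ⟨n, hn⟩ := he χ
  calc 0 < (r n : ℂ) * (star (χ (e n)) * χ (e n)) := mul_pos (hr' n) <|
        (star_mul_self_nonneg _).lt_of_ne' (mul_ne_zero (star_ne_zero.2 hn) hn)
    _ ≤ _ := le_hasSum hχsum n fun m _ => mul_nonneg (hr' m).le (star_mul_self_nonneg _)

variable [PartialOrder A] [StarOrderedRing A]

theorem IsPositiveOnCharacters.nonneg (h : IsPositiveOnCharacters a) : 0 ≤ a :=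
  nonneg_iff_forall_character.2 fun χ => (h χ).le

theorem character_cfcₙ_cutoff (ha : 0 ≤ a) (n : ℕ) (χ : characterSpace ℂ A) :
    χ (cfcₙ (cutoff n) a) = cutoff n (χ a).re :=
  character_cfcₙ χ (continuous_cutoff n) (cutoff_zero_right n) (.of_nonneg ha)

theorem IsPositiveOnCharacters.tendsto_mul_cfcₙ_cutoff (h : IsPositiveOnCharacters a) (b : A) :
    Tendsto (fun n => b * cfcₙ (cutoff n) a) atTop (𝓝 b) := by
  refine Metric.tendsto_nhds.2 fun ε hε => ?_
  filter_upwards [h.eventually_two_le b (half_pos hε)] with n hn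
  rw [dist_eq_norm]
  refine (norm_le_of_forall_character (half_pos hε).le fun χ => ?_).trans_lt (half_lt_self hε)
  have hχ : χ (b * cfcₙ (cutoff n) a - b) = χ b * ((cutoff n (χ a).re - 1 : ℝ) : ℂ) := by
    rw [map_sub, map_mul, character_cfcₙ_cutoff h.nonneg]
    push_cast
    ring
  rw [hχ, norm_mul, Complex.norm_real]
  rcases le_total (ε / 2) ‖χ b‖ with hlarge | hsmall
  · rw [cutoff_of_ge (hn χ hlarge), sub_self, norm_zero, mul_zero]
    exact (half_pos hε).le
  · refine (mul_le_of_le_one_right (norm_nonneg _) ?_).trans hsmall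
    rw [Real.norm_eq_abs, abs_le]
    constructor <;> linarith [cutoff_nonneg n (χ a).re, cutoff_le_one n (χ a).re]

theorem IsPositiveOnCharacters.isAlmostIdempotentApproxUnit (h : IsPositiveOnCharacters a) :
    IsAlmostIdempotentApproxUnit fun n => cfcₙ (cutoff n) a where
  nonneg n := cfcₙ_nonneg fun t _ => cutoff_nonneg n t
  mul_succ n := by
    rw [← cfcₙ_mul (cutoff n) (cutoff (n + 1)) a (continuous_cutoff n).continuousOn
      (cutoff_zero_right n) (continuous_cutoff _).continuousOn (cutoff_zero_right _)]
    simp only [cutoff_mul_cutoff_succ]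
  isSeqApproxIdentity := by
    refine ⟨fun n => norm_cfcₙ_le fun t _ => ?_, fun b => ?_, fun b => ?_⟩
    · rw [Real.norm_of_nonneg (cutoff_nonneg n t)]
      exact cutoff_le_one n t
    · exact tendsto_map'_iff.2 (h.tendsto_mul_cfcₙ_cutoff b)
    · exact tendsto_map'_iff.2 ((h.tendsto_mul_cfcₙ_cutoff b).congr fun n => mul_comm _ _)

theorem exists_isAlmostIdempotentApproxUnit [SigmaCompactSpace (characterSpace ℂ A)] :
    ∃ e : ℕ → A, IsAlmostIdempotentApproxUnit e :=
  let ⟨_, ha⟩ := exists_isPositiveOnCharacters (A := A)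
  ⟨_, ha.isAlmostIdempotentApproxUnit⟩

end PositiveOnCharacters

section StrictlyPositive

theorem positiveLinearMap_eq_zero_of_le_smul {R E F : Type*} [Semiring R] [AddCommMonoid E]
    [PartialOrder E] [Module R E] [AddCommMonoid F] [PartialOrder F] [Module R F] {f : E →ₚ[R] F}
    {x y : E} {r : R} (hx : 0 ≤ x) (hxy : x ≤ r • y) (hy : f y = 0) : f x = 0 := by
  refine le_antisymm ?_ (map_nonneg f hx)
  simpa only [map_smul, hy, smul_zero] using OrderHomClass.mono f hxy

theorem positiveLinearMap_ext_nonneg {A F : Type*} [NonUnitalCStarAlgebra A] [PartialOrder A]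
    [StarOrderedRing A] [AddCommMonoid F] [PartialOrder F] [Module ℂ F] {f g : A →ₚ[ℂ] F}
    (h : ∀ b, 0 ≤ b → f b = g b) : f = g :=
  PositiveLinearMap.toLinearMap_injective (LinearMap.ext_on CStarAlgebra.span_nonneg h)

variable {A : Type u} [NonUnitalCommCStarAlgebra A] [PartialOrder A] [StarOrderedRing A] {a : A}

theorem mul_le_norm_smul {b : A} (ha : 0 ≤ a) (hb : 0 ≤ b) : a * b ≤ (‖b‖ : ℂ) • a := by
  refine le_iff_forall_character.2 fun χ => ?_
  have hχb : χ b ≤ (‖b‖ : ℂ) := by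
    rw [Complex.eq_coe_norm_of_nonneg (map_nonneg χ hb)]
    exact Complex.real_le_real.2 (norm_character_le χ b)
  rw [map_mul, map_smul, smul_eq_mul, mul_comm]
  exact mul_le_mul_of_nonneg_right hχb (map_nonneg χ ha)

theorem cfcₙ_cutoff_le_smul (ha : 0 ≤ a) (n : ℕ) : cfcₙ (cutoff n) a ≤ (2 ^ n : ℂ) • a := by
  refine le_iff_forall_character.2 fun χ => ?_
  obtain ⟨hre, him⟩ := Complex.nonneg_iff.1 (map_nonneg χ ha)
  have hχa : χ a = ((χ a).re : ℂ) := Complex.ext rfl him.symm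
  rw [character_cfcₙ_cutoff ha, map_smul, smul_eq_mul]
  nth_rewrite 2 [hχa]
  exact_mod_cast cutoff_le_mul n hre

theorem StrictlyPositiveElement.isPositiveOnCharacters (h : StrictlyPositiveElement a) :
    IsPositiveOnCharacters a := fun χ => by
  refine h.2 (.mk₀ (CharacterSpace.toCLM χ) fun b hb => map_nonneg χ hb) fun h0 => ?_
  obtain ⟨b, hb⟩ := exists_character_ne_zero χ
  exact hb (DFunLike.congr_fun h0 b)

theorem IsPositiveOnCharacters.strictlyPositiveElement (h : IsPositiveOnCharacters a) :
    StrictlyPositiveElement a := by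
  refine ⟨h.nonneg, fun f hf => (map_nonneg f h.nonneg).lt_of_ne' fun hfa => hf ?_⟩
  have he := h.isAlmostIdempotentApproxUnit
  refine positiveLinearMap_ext_nonneg fun b hb => ?_
  have hfe (n : ℕ) : f (cfcₙ (cutoff n) a) = 0 :=
    positiveLinearMap_eq_zero_of_le_smul (he.nonneg n) (cfcₙ_cutoff_le_smul h.nonneg n) hfa
  have hfbe (n : ℕ) : f (b * cfcₙ (cutoff n) a) = 0 := by
    rw [mul_comm]
    exact positiveLinearMap_eq_zero_of_le_smul ((Commute.all _ b).mul_nonneg (he.nonneg n) hb)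
      (mul_le_norm_smul (he.nonneg n) hb) (hfe n)
  exact tendsto_nhds_unique (((map_continuous f).tendsto b).comp (he.tendsto_mul b))
    (tendsto_const_nhds.congr fun n => (hfbe n).symm)

theorem strictlyPositiveElement_iff_isPositiveOnCharacters :
    StrictlyPositiveElement a ↔ IsPositiveOnCharacters a :=
  ⟨fun h => h.isPositiveOnCharacters, fun h => h.strictlyPositiveElement⟩

end StrictlyPositive

end BanachHomology

open BanachHomology in
theorem theorem6p2 {A : Type u} [NonUnitalCommCStarAlgebra A] [PartialOrder A] [StarOrderedRing A]
    (hA : SuslinCondition (WeakDual.characterSpace ℂ A)) :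
    List.TFAE
      [IsLeftProjective A,
       ParacompactSpace (WeakDual.characterSpace ℂ A),
       ∃ a : A, StrictlyPositiveElement a,
       SigmaCompactSpace (WeakDual.characterSpace ℂ A),
       LindelofSpace (WeakDual.characterSpace ℂ A),
       ∃ e : ℕ → A, IsSeqApproxIdentityBoundedByOne e,
       ∀ (X : Type u) [NormedAddCommGroup X] [NormedSpace ℂ X] [CompleteSpace X]
         (β : BiAction A X), β.IsRightAnnihilator → Subsingleton β.H2] := by
  tfae_have 1 → 4 := hA.sigmaCompactSpace_of_isLeftProjective
  tfae_have 4 → 1 := fun _ =>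
    let ⟨_, he⟩ := exists_isAlmostIdempotentApproxUnit (A := A)
    he.isLeftProjective
  tfae_have 2 → 4 := fun _ => hA.sigmaCompactSpace_of_paracompactSpace
  tfae_have 4 → 2 := fun _ => inferInstance
  tfae_have 3 → 4 := fun ⟨_, ha⟩ =>
    (strictlyPositiveElement_iff_isPositiveOnCharacters.1 ha).sigmaCompactSpace
  tfae_have 4 → 3 := fun _ =>
    exists_isPositiveOnCharacters.imp fun _ => strictlyPositiveElement_iff_isPositiveOnCharacters.2
  tfae_have 5 → 4 := fun _ => sigmaCompactSpace_of_lindelofSpace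
  tfae_have 4 → 5 := fun _ => inferInstance
  tfae_have 6 → 4 := fun ⟨e, he⟩ =>
    sigmaCompactSpace_characterSpace_iff.2 ⟨e, he.exists_character_ne_zero⟩
  tfae_have 4 → 6 := fun _ =>
    exists_isAlmostIdempotentApproxUnit.imp fun _ he => he.isSeqApproxIdentity
  tfae_have 1 ↔ 7 := isLeftProjective_iff_subsingleton_H2
  tfae_finish
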